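/- Let $k$ be a field of characteristic $p=0$ or $p>d$, and let $f(t,x)\in k[t,x]$ be an indecomposable polynomial of total degree $d$, that is, $f$ is non-constant and is not of the form $u(g(t,x))$ with $u\in k[y]$ of degree at least $2$ and $g\in k[t,x]$. Let $S$ be a non-empty finite subset of $k$. If $(\alpha,t)$ is chosen uniformly at random in $S\times S$, then the probability that $f(t+\alpha x,x)$ is indecomposable in $k[x]$ is at least $$1-\frac{\mathcal D}{|S|},\qquad \mathcal D=\sigma_1(d)\,d^2+2\sigma_0(d)\,d,$$ where $\sigma_1(d)=\sum_{m\mid d}m$, $\sigma_0(d)$ is the number of positive divisors of $d$, and $|S|$ is the cardinality of $S$. Here a one-variable polynomial in $k[x]$ is called indecomposable if it is non-constant and is not of the form $u(g(x))$ with $u,g\in k[x]$ both of degree at least $2$. -/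

import Mathlib

open Polynomial

/-- Decomposability in one variable: `f = u(g)` with `u, g ∈ k[x]` both of degree at least `2`. -/
def IsDecomposable {k : Type*} [Field k] (f : k[X]) : Prop :=
  ∃ u g : k[X], 2 ≤ u.natDegree ∧ 2 ≤ g.natDegree ∧ f = u.comp g

/-- Indecomposability in one variable: non-constant and not decomposable. -/
def IsIndecomposable {k : Type*} [Field k] (f : k[X]) : Prop :=
  0 < f.natDegree ∧ ¬ IsDecomposable f

/-- Decomposability in `n ≥ 2` variables: `f = u(g)` with `u` a one-variable polynomial of degree
at least `2` and `g` any polynomial in the same variables as `f` (its degree may be `1`). -/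
def IsMvDecomposable {k : Type*} [Field k] {n : ℕ} (f : MvPolynomial (Fin n) k) : Prop :=
  ∃ (u : k[X]) (g : MvPolynomial (Fin n) k), 2 ≤ u.natDegree ∧ f = Polynomial.aeval g u

/-- Indecomposability in `n ≥ 2` variables: non-constant and not decomposable. -/
def IsMvIndecomposable {k : Type*} [Field k] {n : ℕ} (f : MvPolynomial (Fin n) k) : Prop :=
  0 < f.totalDegree ∧ ¬ IsMvDecomposable f

/-- For `f(t, x)`, with variable `0` standing for `t` and variable `1` for `x`, the one-variable
polynomial `f(t₀ + α₀ x, x)`. -/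
noncomputable def specialize {k : Type*} [Field k] (f : MvPolynomial (Fin 2) k) (α₀ t₀ : k) :
    k[X] :=
  MvPolynomial.aeval ![C t₀ + C α₀ * X, X] f

/-! Let F = f(t + αx, x), viewed in k[α][t][x]. Its leading coefficient c in x is a nonzero
polynomial in α alone, and c^(d-1) F(x/c) is monic. For d = mn with m, n ≥ 2, the integer m is
invertible in k, so this monic polynomial has an approximate m-th root g of degree n, and a g-adic
expansion Σ r_i g^i with r_m = 1 and r_(m-1) = 0.

Suppose that at a point (a, b) with c(a) ≠ 0 the specialization is u(h) with deg u = m, deg h = n.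
Completing the m-th power shows that the specialized g is an affine function of the (rescaled) h, so
every specialized r_i is constant in x (`adic_coeff_eq_C_of_eq_comp`). Hence a coefficient of
positive x-degree in some r_i is a polynomial R(α, t) vanishing at all such points.

A nonzero R of this kind exists because f is indecomposable. Otherwise all r_i = u_i lie in k[α][t].
The derivation ∂_α - x ∂_t kills F, and comparing digits of the expansion forces ∂_t u_i = 0
(`derivation_eq_zero_of_lineDerivation_eq_zero`). Setting α = a with c(a) ≠ 0 and replacing t by t -
ax then writes f as a polynomial over k in another polynomial (`isMvDecomposable_of_expansion`).

Give x weight 1, and give weight j to polynomials of degree at most j in t and dj in α. All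
constructions respect weights, so R has degree at most d in t and d² in α. Counting the zeros of c
and of one R for each m leaves at most (d + σ₀(d)(d + d²))|S| ≤ 𝒟|S| bad pairs. -/

/-! ### Weighted degrees and expansions in powers of a monic polynomial -/

section Weighted

variable {k A : Type*} [CommRing k] [CommRing A] [Algebra k A]

/-- Given subspaces `M j` of `A`, the polynomials of weighted degree at most `e`, where the variable
has weight `1`: the coefficient of `X ^ l` lies in `M (e - l)`. -/
def weighted (M : ℤ → Submodule k A) (e : ℤ) : Submodule k A[X] where
  carrier := {P | ∀ l : ℕ, P.coeff l ∈ M (e - l)}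
  add_mem' hP hQ l := by
    rw [coeff_add]
    exact add_mem (hP l) (hQ l)
  zero_mem' l := by simp
  smul_mem' c P hP l := by
    rw [coeff_smul]
    exact Submodule.smul_mem _ c (hP l)

variable {M : ℤ → Submodule k A}

theorem monomial_mem_weighted {e : ℤ} {l : ℕ} {a : A} (ha : a ∈ M (e - l)) :
    monomial l a ∈ weighted M e := by
  intro i
  rw [coeff_monomial]
  split_ifs with h
  · subst h
    exact ha
  · exact zero_mem _

theorem mul_mem_weighted (hmul : ∀ i j a b, a ∈ M i → b ∈ M j → a * b ∈ M (i + j))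
    {e e' : ℤ} {P Q : A[X]} (hP : P ∈ weighted M e) (hQ : Q ∈ weighted M e') :
    P * Q ∈ weighted M (e + e') := by
  intro l
  rw [coeff_mul]
  refine sum_mem fun x hx ↦ ?_
  have hx' : (x.1 : ℤ) + x.2 = l := by exact_mod_cast Finset.HasAntidiagonal.mem_antidiagonal.1 hx
  have := hmul _ _ _ _ (hP x.1) (hQ x.2)
  rwa [show e - x.1 + (e' - x.2) = e + e' - l by rw [← hx']; ring] at this

theorem pow_mem_weighted (hone : 1 ∈ M 0)
    (hmul : ∀ i j a b, a ∈ M i → b ∈ M j → a * b ∈ M (i + j))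
    {e : ℤ} {P : A[X]} (hP : P ∈ weighted M e) (m : ℕ) :
    P ^ m ∈ weighted M (m * e) := by
  induction m with
  | zero =>
    rw [pow_zero, ← monomial_zero_one]
    exact monomial_mem_weighted (by simpa using hone)
  | succ m ih =>
    rw [pow_succ]
    have := mul_mem_weighted hmul ih hP
    rwa [show (m : ℤ) * e + e = (m + 1 : ℕ) * e by push_cast; ring] at this

/-- Each step of long division subtracts g times a monomial of the complementary weight, so the
weight bound survives; uniqueness of quotient and remainder identifies the result. -/
theorem divByMonic_modByMonic_mem_weighted
    (hmul : ∀ i j a b, a ∈ M i → b ∈ M j → a * b ∈ M (i + j))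
    {g : A[X]} (hg : g.Monic) (hgW : g ∈ weighted M g.natDegree) {e : ℤ} (P : A[X])
    (hP : P ∈ weighted M e) :
    P /ₘ g ∈ weighted M (e - g.natDegree) ∧ P %ₘ g ∈ weighted M e := by
  nontriviality A
  suffices h : ∀ N (P : A[X]), P.natDegree < N → P ∈ weighted M e →
      ∃ q ∈ weighted M (e - g.natDegree), ∃ r ∈ weighted M e,
        r + g * q = P ∧ r.degree < g.degree by
    obtain ⟨q, hq, r, hr, h⟩ := h _ P (Nat.lt_succ_self _) hP
    obtain ⟨h1, h2⟩ := div_modByMonic_unique q r hg h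
    rw [h1, h2]
    exact ⟨hq, hr⟩
  intro N
  induction N with
  | zero => intro P h; omega
  | succ N ih =>
    intro P hN hP
    by_cases hdeg : P.degree < g.degree
    · exact ⟨0, zero_mem _, P, hP, by simp, hdeg⟩
    have hdeg' : g.degree ≤ P.degree := not_lt.1 hdeg
    have hnat : g.natDegree ≤ P.natDegree := natDegree_le_natDegree hdeg'
    set T : A[X] := monomial (P.natDegree - g.natDegree) P.leadingCoeff with hT
    have hTW : T ∈ weighted M (e - g.natDegree) := by
      refine monomial_mem_weighted ?_
      have := hP P.natDegree
      rwa [Nat.cast_sub hnat, show e - (g.natDegree : ℤ) - (P.natDegree - g.natDegree)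
        = e - P.natDegree by ring]
    have hgT : g * T ∈ weighted M e := by
      have := mul_mem_weighted hmul hgW hTW
      rwa [show (g.natDegree : ℤ) + (e - g.natDegree) = e by ring] at this
    have hP0 : P ≠ 0 := by
      rintro rfl
      rw [degree_zero, le_bot_iff, degree_eq_bot] at hdeg'
      exact hg.ne_zero hdeg'
    -- Cancelling the leading term of a constant does not lower `natDegree`, so g = 1 is treated
    -- apart.
    by_cases hd0 : g.natDegree = 0
    · have hg1 : g = 1 := by
        rw [eq_C_of_natDegree_eq_zero hd0]
        have := hg.coeff_natDegree
        rw [hd0] at this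
        rw [this, C_1]
      refine ⟨P, ?_, 0, zero_mem _, by simp [hg1], by simp [hg1]⟩
      simpa [hd0] using hP
    have hlt : (P - g * T).natDegree < N := by
      have h1 : (P - g * T).degree < P.degree := by
        have := div_wf_lemma ⟨hdeg', hP0⟩ hg
        rwa [C_mul_X_pow_eq_monomial] at this
      by_cases h0 : P - g * T = 0
      · rw [h0, natDegree_zero]
        omega
      · have := natDegree_lt_natDegree h0 h1
        omega
    obtain ⟨q, hq, r, hr, h1, h2⟩ := ih _ hlt (sub_mem hP hgT)
    exact ⟨q + T, add_mem hq hTW, r, hr, by rw [mul_add, ← add_assoc, h1]; ring, h2⟩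

/-- Existence of the `g`-adic expansion, with control of the weighted degrees. -/
theorem exists_adic_expansion
    (hmul : ∀ i j a b, a ∈ M i → b ∈ M j → a * b ∈ M (i + j))
    {g : A[X]} (hg : g.Monic) (hg0 : 0 < g.natDegree) (hgW : g ∈ weighted M g.natDegree) (N : ℕ)
    (e : ℤ) (P : A[X]) (hP : P ∈ weighted M e) (hN : P.natDegree < (N + 1) * g.natDegree) :
    ∃ r : ℕ → A[X], (∀ i, (r i).natDegree < g.natDegree) ∧
      (∀ i : ℕ, r i ∈ weighted M (e - g.natDegree * i)) ∧
      P = ∑ i ∈ Finset.range (N + 1), r i * g ^ i := by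
  induction N generalizing P e with
  | zero =>
    refine ⟨fun i ↦ if i = 0 then P else 0, fun i ↦ ?_, fun i ↦ ?_, by simp⟩
    · dsimp only
      split_ifs
      · omega
      · simpa using hg0
    · dsimp only
      split_ifs with h
      · simpa [h] using hP
      · exact zero_mem _
  | succ N ih =>
    obtain ⟨hq, hr⟩ := divByMonic_modByMonic_mem_weighted hmul hg hgW P hP
    obtain ⟨s, hs1, hs2, hs3⟩ := ih _ _ hq (by
      have := add_mul (N + 1) 1 g.natDegree
      have := Nat.mul_le_mul_right g.natDegree (Nat.le_add_left 1 N)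
      rw [natDegree_divByMonic _ hg]
      omega)
    refine ⟨fun i ↦ if i = 0 then P %ₘ g else s (i - 1), fun i ↦ ?_, fun i ↦ ?_, ?_⟩
    · dsimp only
      split_ifs
      · exact natDegree_modByMonic_lt _ hg fun h ↦ by simp [h] at hg0
      · exact hs1 _
    · dsimp only
      split_ifs with h
      · simpa [h] using hr
      · have := hs2 (i - 1)
        rw [Nat.cast_sub (by omega)] at this
        rwa [show e - (g.natDegree : ℤ) - g.natDegree * (i - (1 : ℕ)) = e - g.natDegree * i by
          push_cast; ring] at this
    · rw [Finset.sum_range_succ']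
      simp only [Nat.add_eq_zero_iff, one_ne_zero, and_false, if_false, if_true, pow_zero, mul_one,
        Nat.add_sub_cancel]
      conv_lhs => rw [← modByMonic_add_div P g, hs3]
      rw [Finset.mul_sum, add_comm]
      congr 1
      refine Finset.sum_congr rfl fun i _ ↦ ?_
      ring

end Weighted

/-- Uniqueness of the expansion in powers of a non-constant polynomial. -/
theorem eq_zero_of_adic_expansion_eq_zero {A : Type*} [CommRing A] [IsDomain A] {G : A[X]}
    (hG : 0 < G.natDegree) (N : ℕ) (s : ℕ → A[X]) (hs : ∀ i < N, (s i).natDegree < G.natDegree)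
    (h : ∑ i ∈ Finset.range N, s i * G ^ i = 0) : ∀ i < N, s i = 0 := by
  have hG0 : G ≠ 0 := by rintro rfl; simp at hG
  induction N generalizing s with
  | zero => intro i hi; omega
  | succ N ih =>
    have hsum : (∑ i ∈ Finset.range N, s (i + 1) * G ^ i) * G + s 0 = 0 := by
      rw [← h, Finset.sum_range_succ', Finset.sum_mul]
      simp only [pow_zero, mul_one, pow_succ, mul_assoc]
    -- A nonzero multiple of G has degree at least deg G, too large to cancel against the digit s 0.
    have hz : ∑ i ∈ Finset.range N, s (i + 1) * G ^ i = 0 := by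
      by_contra hne
      have h1 : s 0 = -((∑ i ∈ Finset.range N, s (i + 1) * G ^ i) * G) := by
        linear_combination hsum
      have h2 := hs 0 (by omega)
      rw [h1, natDegree_neg, natDegree_mul hne hG0] at h2
      omega
    intro i hi
    rcases i with _ | i
    · simpa [hz] using hsum
    · exact ih (fun i ↦ s (i + 1)) (fun i hi ↦ hs _ (by omega)) hz i (by omega)

/-! ### Approximate roots -/

section ApproximateRoot

variable {A : Type*} [CommRing A]

/-- The sum `∑ g ^ j * h ^ (m - 1 - j)` for `g`, `h` of degree at most `n` has degree at most
`(m - 1) * n`; if `g` and `h` are monic of degree `n`, its coefficient there is `m`. -/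
theorem natDegree_geom_sum_le {g h : A[X]} {n : ℕ} (hgn : g.natDegree ≤ n)
    (hhn : h.natDegree ≤ n) (m : ℕ) :
    (∑ j ∈ Finset.range m, g ^ j * h ^ (m - 1 - j)).natDegree ≤ (m - 1) * n := by
  refine natDegree_sum_le_of_forall_le _ _ fun j hj ↦ ?_
  have hj := Finset.mem_range.1 hj
  refine natDegree_mul_le.trans ?_
  calc _ ≤ j * n + (m - 1 - j) * n :=
        add_le_add (natDegree_pow_le_of_le _ hgn) (natDegree_pow_le_of_le _ hhn)
    _ = (m - 1) * n := by rw [← add_mul]; congr 1; omega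

theorem coeff_geom_sum {g h : A[X]} {n : ℕ} (hg : g.Monic) (hh : h.Monic)
    (hgn : g.natDegree = n) (hhn : h.natDegree = n) (m : ℕ) :
    (∑ j ∈ Finset.range m, g ^ j * h ^ (m - 1 - j)).coeff ((m - 1) * n) = m := by
  rw [finsetSum_coeff]
  rw [Finset.sum_congr rfl (g := fun _ ↦ (1 : A)), Finset.sum_const, Finset.card_range, nsmul_one]
  intro j hj
  have hj := Finset.mem_range.1 hj
  nontriviality A
  have hmon : (g ^ j * h ^ (m - 1 - j)).Monic := (hg.pow j).mul (hh.pow _)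
  have hd : (g ^ j * h ^ (m - 1 - j)).natDegree = (m - 1) * n := by
    rw [(hg.pow j).natDegree_mul (hh.pow _), hg.natDegree_pow, hh.natDegree_pow, hgn, hhn,
      ← add_mul]
    congr 1
    omega
  rw [← hd]
  exact hmon

variable {k : Type*} [Field k] [Algebra k A] {M : ℤ → Submodule k A}

/-- Existence of the approximate `m`-th root of a monic polynomial of degree `m * n`. -/
theorem exists_approximate_root [Nontrivial A] (hone : 1 ∈ M 0)
    (hmul : ∀ i j a b, a ∈ M i → b ∈ M j → a * b ∈ M (i + j))
    {m n : ℕ} (hm : (m : k) ≠ 0) {F : A[X]} (hF : F.Monic) (hFd : F.natDegree = m * n)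
    (hFW : F ∈ weighted M (m * n : ℕ)) :
    ∃ g : A[X], g.Monic ∧ g.natDegree = n ∧ g ∈ weighted M n ∧
      ∀ l, (m - 1) * n ≤ l → (F - g ^ m).coeff l = 0 := by
  have hm0 : m ≠ 0 := by rintro rfl; simp at hm
  have hmn : (m - 1) * n + n = m * n := by
    rw [← Nat.succ_mul]; congr 1; omega
  -- Start from x^n and correct one coefficient of g at a time, from the top; after s corrections F
  -- and g^m agree in degrees at least mn - s.
  suffices h : ∀ s ≤ n, ∃ g : A[X], g.Monic ∧ g.natDegree = n ∧ g ∈ weighted M n ∧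
      ∀ l, m * n ≤ l + s → (F - g ^ m).coeff l = 0 by
    obtain ⟨g, h1, h2, h3, h4⟩ := h n le_rfl
    exact ⟨g, h1, h2, h3, fun l hl ↦ h4 l (by omega)⟩
  intro s
  induction s with
  | zero =>
    intro _
    refine ⟨X ^ n, monic_X_pow n, natDegree_X_pow n, ?_, fun l hl ↦ ?_⟩
    · rw [← monomial_one_right_eq_X_pow]
      exact monomial_mem_weighted (by simpa using hone)
    · rw [← pow_mul, mul_comm n m, coeff_sub, coeff_X_pow]
      split_ifs with h
      · rw [h, ← hFd, hF.coeff_natDegree, sub_self]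
      · rw [coeff_eq_zero_of_natDegree_lt (by omega), sub_zero]
  | succ s ih =>
    intro hs
    obtain ⟨g, hg, hgn, hgW, hgl⟩ := ih (by omega)
    set i := n - (s + 1) with hi
    set δ := (F - g ^ m).coeff ((m - 1) * n + i) with hδ
    -- Adding a x^i to g changes g^m by a x^i Q with Q of degree (m-1)n and top coefficient m, so
    -- the first wrong coefficient δ is removed by a = δ/m.
    set a : A := (m : k)⁻¹ • δ with ha
    have hma : a * m = δ := by
      rw [ha, ← map_natCast (algebraMap k A), mul_comm, ← Algebra.smul_def, smul_smul,
        mul_inv_cancel₀ hm, one_smul]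
    have hTn : (monomial i a).natDegree < n := (natDegree_monomial_le a).trans_lt (by omega)
    have hTd : (monomial i a).degree < g.degree :=
      degree_lt_degree (by omega)
    have hg' : (g + monomial i a).Monic := hg.add_of_left hTd
    have hgn' : (g + monomial i a).natDegree = n := by
      rw [natDegree_add_eq_left_of_degree_lt hTd, hgn]
    refine ⟨g + monomial i a, hg', hgn', ?_, fun l hl ↦ ?_⟩
    · refine add_mem hgW (monomial_mem_weighted (Submodule.smul_mem _ _ ?_))
      have h1 := pow_mem_weighted hone hmul hgW m
      have h2 := sub_mem hFW (by exact_mod_cast h1) ((m - 1) * n + i)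
      rw [← hmn] at h2
      rwa [show (((m - 1) * n + n : ℕ) : ℤ) - ((m - 1) * n + i : ℕ) = n - i by
        push_cast; ring] at h2
    · have hgeom : (g + monomial i a) ^ m = g ^ m + monomial i a *
          ∑ j ∈ Finset.range m, (g + monomial i a) ^ j * g ^ (m - 1 - j) := by
        have := (Commute.all (g + monomial i a) g).mul_geom_sum₂ m
        rw [add_sub_cancel_left] at this
        rw [this, add_sub_cancel]
      have hQ := natDegree_geom_sum_le hgn'.le hgn.le m
      have hQm := coeff_geom_sum hg' hg hgn' hgn m
      rw [hgeom, ← sub_sub, coeff_sub, sub_eq_zero]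
      by_cases hl' : m * n ≤ l + s
      · rw [hgl l hl', show l = (l - i) + i by omega, coeff_monomial_mul,
          coeff_eq_zero_of_natDegree_lt (by omega), mul_zero]
      · have : l = (m - 1) * n + i := by omega
        rw [this, coeff_monomial_mul, hQm, hma]

/-- Uniqueness of the approximate root. -/
theorem approximate_root_unique {m n : ℕ} (hm : (m : k) ≠ 0) {g h : k[X]}
    (hg : g.Monic) (hh : h.Monic) (hgn : g.natDegree = n) (hhn : h.natDegree = n)
    (hgh : ∀ l, (m - 1) * n ≤ l → (g ^ m).coeff l = (h ^ m).coeff l) : g = h := by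
  by_contra hne
  have hsub : g - h ≠ 0 := sub_ne_zero.2 hne
  have hQ := coeff_geom_sum hg hh hgn hhn m
  have hle := natDegree_geom_sum_le hgn.le hhn.le m
  have hgeom := (Commute.all g h).mul_geom_sum₂ m
  set Q := ∑ j ∈ Finset.range m, g ^ j * h ^ (m - 1 - j)
  have hQ0 : Q ≠ 0 := by
    intro h0
    rw [h0, coeff_zero] at hQ
    exact hm hQ.symm
  have hQd : Q.natDegree = (m - 1) * n :=
    le_antisymm hle (le_natDegree_of_ne_zero (by rwa [hQ]))
  have hne' : (g - h) * Q ≠ 0 := mul_ne_zero hsub hQ0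
  have h2 := hgh ((g - h) * Q).natDegree (by rw [natDegree_mul hsub hQ0]; omega)
  rw [← sub_eq_zero, ← coeff_sub, ← hgeom] at h2
  exact leadingCoeff_ne_zero.2 hne' h2

end ApproximateRoot

/-! ### The derivation δ - Xτ and digits of an expansion -/

section CoefficientDerivation

variable {R A : Type*} [CommRing R] [CommRing A] [Algebra R A]

/-- The derivation of `A[X]` that applies a derivation of `A` to the coefficients. -/
noncomputable def coeffDerivation (δ : Derivation R A A) : Derivation R A[X] A[X] :=
  PolynomialModule.equivPolynomialSelf.compDer δ.mapCoeffs

@[simp]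
theorem coeff_coeffDerivation (δ : Derivation R A A) (P : A[X]) (i : ℕ) :
    (coeffDerivation δ P).coeff i = δ (P.coeff i) := rfl

@[simp]
theorem coeffDerivation_C (δ : Derivation R A A) (a : A) :
    coeffDerivation δ (C a) = C (δ a) := by
  ext i
  rw [coeff_coeffDerivation, coeff_C, coeff_C]
  split_ifs <;> simp

@[simp]
theorem coeffDerivation_X (δ : Derivation R A A) : coeffDerivation δ X = 0 := by
  ext i
  rw [coeff_coeffDerivation, coeff_X]
  split_ifs <;> simp

/-- The derivation `δ - X τ` of `A[X]`, for derivations `δ` and `τ` of `A`. -/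
noncomputable def lineDerivation (δ τ : Derivation R A A) : Derivation R A[X] A[X] :=
  coeffDerivation δ - (X : A[X]) • coeffDerivation τ

theorem lineDerivation_apply (δ τ : Derivation R A A) (P : A[X]) :
    lineDerivation δ τ P = coeffDerivation δ P - X * coeffDerivation τ P := rfl

theorem lineDerivation_C (δ τ : Derivation R A A) (a : A) :
    lineDerivation δ τ (C a) = C (δ a) - X * C (τ a) := by
  rw [lineDerivation_apply, coeffDerivation_C, coeffDerivation_C]

/-- Only the term -X τ(·) can raise the degree, and it does so only through the coefficient of
degree n. -/
theorem natDegree_lineDerivation_le (δ τ : Derivation R A A) {n : ℕ} {G : A[X]}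
    (hG : G.natDegree ≤ n) (hτ : τ (G.coeff n) = 0) :
    (lineDerivation δ τ G).natDegree ≤ n := by
  rw [natDegree_le_iff_coeff_eq_zero]
  intro l hl
  obtain ⟨l, rfl⟩ := Nat.exists_eq_add_one_of_ne_zero (by omega : l ≠ 0)
  rw [lineDerivation_apply, coeff_sub, coeff_X_mul, coeff_coeffDerivation, coeff_coeffDerivation,
    coeff_eq_zero_of_natDegree_lt (by omega), map_zero, zero_sub, neg_eq_zero]
  rcases (Nat.lt_succ_iff.1 hl).eq_or_lt with rfl | h
  · exact hτ
  · rw [coeff_eq_zero_of_natDegree_lt (by omega), map_zero]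

/-- If `δ - X τ` kills `F` and `F`, up to a `τ`-constant, equals `u(G)` with `u` monic of degree
`m` without term of degree `m - 1` and `G` of degree at least `2` with a `τ`-constant leading
coefficient, then the coefficients of `u` are `τ`-constants. -/
theorem derivation_eq_zero_of_lineDerivation_eq_zero [IsDomain A] (δ τ : Derivation R A A)
    {F G : A[X]} (hF : lineDerivation δ τ F = 0) {B : A} (hB : B ≠ 0) (hτB : τ B = 0)
    (hG : 2 ≤ G.natDegree) (hτG : τ G.leadingCoeff = 0) {m : ℕ} (hm : 0 < m) (hmA : (m : A) ≠ 0)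
    (u : ℕ → A) (hum : u m = 1) (hum1 : u (m - 1) = 0) (hum2 : u (m + 1) = 0)
    (h : C B * F = ∑ i ∈ Finset.range (m + 1), C (u i) * G ^ i) :
    ∀ i ≤ m, τ (u i) = 0 := by
  set n := G.natDegree with hn
  set L := G.leadingCoeff with hL
  have hL0 : L ≠ 0 := leadingCoeff_ne_zero.2 (by rintro rfl; simp at hn; omega)
  set D := lineDerivation δ τ with hD
  set e := (D G).coeff n with he
  -- Pseudo-remainder of D G by G: L · D G = e G + r with deg r < n.
  set r := C L * D G - C e * G with hr
  have hDG : (D G).natDegree ≤ n := natDegree_lineDerivation_le δ τ le_rfl hτG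
  have hrn : r.natDegree < n := by
    have h1 : r.natDegree ≤ n := by
      refine (natDegree_sub_le _ _).trans (max_le ?_ ?_)
      · exact (natDegree_C_mul_le _ _).trans hDG
      · exact natDegree_C_mul_le _ _
    have h2 : r.coeff n = 0 := by
      rw [hr, coeff_sub, coeff_C_mul, coeff_C_mul, ← he]
      change L * e - e * L = 0
      ring
    refine lt_of_le_of_ne h1 fun h3 ↦ ?_
    rw [← h3] at h2
    rw [leadingCoeff_eq_zero.1 h2, natDegree_zero] at h3
    omega
  have hDu (a : A) : D (C a) = C (δ a) - X * C (τ a) := lineDerivation_C δ τ a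
  -- These are the G-adic digits of L δ(B) · (BF) - BL · D(BF), which vanishes since D F = 0 and τ B
  -- = 0. The term in r comes from differentiating G^(i+1).
  set s : ℕ → A[X] := fun i ↦ C (L * δ B * u i) - C (B * L) * (C (δ (u i)) - X * C (τ (u i)))
    - C (B * i * u i * e) - C (B * (i + 1) * u (i + 1)) * r with hs
  have hsum : ∑ i ∈ Finset.range (m + 1), s i * G ^ i = 0 := by
    have e1 : D (C B * F) = C (δ B) * F := by
      rw [Derivation.leibniz, hF, hDu, hτB]
      simp [mul_comm]
    have e2 : D (C B * F) = ∑ i ∈ Finset.range (m + 1), ((C (δ (u i)) - X * C (τ (u i))) * G ^ i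
        + C (u i * i) * G ^ (i - 1) * D G) := by
      rw [h, map_sum]
      refine Finset.sum_congr rfl fun i _ ↦ ?_
      rw [Derivation.leibniz, Derivation.leibniz_pow, hDu]
      simp only [smul_eq_mul, nsmul_eq_mul, C_mul, C_eq_natCast]
      ring
    have e3 : ∑ i ∈ Finset.range (m + 1), C (B * u i * i) * G ^ (i - 1) * r
        = ∑ i ∈ Finset.range (m + 1), C (B * (i + 1) * u (i + 1)) * r * G ^ i := by
      rw [Finset.sum_range_succ', Finset.sum_range_succ _ m, hum2]
      simp only [Nat.cast_zero, mul_zero, C_0, zero_mul, add_zero]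
      refine Finset.sum_congr rfl fun i _ ↦ ?_
      simp only [Nat.add_sub_cancel, Nat.cast_add, Nat.cast_one, C_mul, C_add]
      ring
    have e4 : ∑ i ∈ Finset.range (m + 1), C (B * L) * (C (u i * i) * G ^ (i - 1) * D G)
        = ∑ i ∈ Finset.range (m + 1), C (B * i * u i * e) * G ^ i
          + ∑ i ∈ Finset.range (m + 1), C (B * u i * i) * G ^ (i - 1) * r := by
      rw [← Finset.sum_add_distrib]
      refine Finset.sum_congr rfl fun i _ ↦ ?_
      have hrr : C L * D G = C e * G + r := by rw [hr]; ring
      have : C (B * L) * (C (u i * i) * G ^ (i - 1) * D G)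
          = C (B * (u i * i)) * G ^ (i - 1) * (C L * D G) := by
        simp only [C_mul]; ring
      rw [this, hrr]
      rcases i with _ | i
      · simp
      · simp only [Nat.add_sub_cancel, C_mul, pow_succ]; ring
    have e5 : C (L * δ B) * (∑ i ∈ Finset.range (m + 1), C (u i) * G ^ i)
        = C (B * L) * D (C B * F) := by
      rw [← h, e1]
      simp only [C_mul]; ring
    simp only [hs, sub_mul, Finset.sum_sub_distrib, ← e3]
    rw [e2, Finset.mul_sum, Finset.mul_sum] at e5
    simp only [mul_add, Finset.sum_add_distrib] at e5
    rw [e4] at e5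
    simp only [C_mul, sub_mul, mul_sub, Finset.sum_sub_distrib, mul_assoc] at e5 ⊢
    linear_combination e5
  have hsn : ∀ i < m + 1, (s i).natDegree < n := by
    intro i _
    have h1 : (C (B * L) * (C (δ (u i)) - X * C (τ (u i)))).natDegree < n := by
      refine lt_of_le_of_lt (natDegree_C_mul_le _ _) (lt_of_le_of_lt (b := 1) ?_ (by omega))
      compute_degree
    have h2 := (natDegree_C_mul_le (B * (i + 1) * u (i + 1)) r).trans_lt hrn
    refine (natDegree_sub_le _ _).trans_lt (max_lt ?_ h2)
    refine (natDegree_sub_le _ _).trans_lt (max_lt ?_ (by rw [natDegree_C]; omega))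
    exact (natDegree_sub_le _ _).trans_lt (max_lt (by rw [natDegree_C]; omega) h1)
  have hs0 := eq_zero_of_adic_expansion_eq_zero (by omega) _ s hsn hsum
  -- In the digit m - 1, u (m - 1) = 0 and u m = 1 leave only -B m r.
  have hr0 : r = 0 := by
    have := hs0 (m - 1) (by omega)
    simp only [hs, hum1, Nat.sub_add_cancel hm, hum, map_zero, mul_zero, zero_mul, sub_zero,
      zero_sub, neg_eq_zero, mul_one] at this
    have hc : (((m - 1 : ℕ) : A) + 1) = m := by
      rw [← Nat.cast_add_one, Nat.sub_add_cancel hm]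
    rw [hc, mul_eq_zero, C_eq_zero] at this
    exact this.resolve_left (mul_ne_zero hB hmA)
  intro i hi
  have := congrArg (coeff · 1) (hs0 i (by omega))
  simp only [hs, hr0, mul_zero, sub_zero, coeff_sub, coeff_C_mul, coeff_X_mul, coeff_zero,
    coeff_C_zero, coeff_C_of_ne_zero one_ne_zero, zero_sub, mul_neg, neg_neg] at this
  exact (mul_eq_zero.1 this).resolve_left (mul_ne_zero hB hL0)

end CoefficientDerivation

/-! ### Compositions in one variable -/

section Univariate

variable {k : Type*} [Field k]

/-- If `F = u(h)` with `u` of degree `m` and `F` is monic, then the expansion of `F` in powers of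
its approximate `m`-th root has constant coefficients. -/
theorem adic_coeff_eq_C_of_eq_comp {m n : ℕ} (hm : 2 ≤ m) (hmk : (m : k) ≠ 0) (hn : 0 < n)
    {F g u h : k[X]} (hF : F.Monic) (hg : g.Monic) (hgn : g.natDegree = n) (r : ℕ → k[X])
    (hr : ∀ i ≤ m, (r i).natDegree < n) (hrm : r m = 1) (hrm1 : r (m - 1) = 0)
    (hFr : F = ∑ i ∈ Finset.range (m + 1), r i * g ^ i)
    (hum : u.natDegree = m) (hhn : h.natDegree = n) (hFu : F = u.comp h) :
    ∀ i ≤ m, (r i).natDegree = 0 := by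
  have hh0 : h ≠ 0 := by rintro rfl; simp at hhn; omega
  have hb : h.leadingCoeff ≠ 0 := leadingCoeff_ne_zero.2 hh0
  obtain ⟨u₁, h₁, hu₁m, hh₁, hh₁n, hFu₁⟩ : ∃ u₁ h₁ : k[X], u₁.natDegree = m ∧ h₁.Monic ∧
      h₁.natDegree = n ∧ F = u₁.comp h₁ := by
    refine ⟨u.comp (C h.leadingCoeff * X), C h.leadingCoeff⁻¹ * h, ?_, ?_, ?_, ?_⟩
    · rw [natDegree_comp, natDegree_C_mul_X _ hb, mul_one, hum]
    · rw [Monic, leadingCoeff_mul, leadingCoeff_C, inv_mul_cancel₀ hb]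
    · rw [natDegree_C_mul (inv_ne_zero hb), hhn]
    · rw [comp_assoc, mul_comp, C_comp, X_comp, ← mul_assoc, ← C_mul, mul_inv_cancel₀ hb, C_1,
        one_mul, hFu]
  have hu₁ : u₁.Monic := by
    have := hF
    rwa [hFu₁, Monic, leadingCoeff_comp (by omega), hh₁.leadingCoeff, one_pow, mul_one] at this
  set e := u₁.coeff (m - 1) with he
  -- Completing the m-th power: (h₁ + e/m)^m matches F in all degrees at least (m-1)n, so h₁ + e/m
  -- is the approximate root.
  set a := e * (m : k)⁻¹ with ha
  have ham : a * m = e := by rw [ha, mul_assoc, inv_mul_cancel₀ hmk, mul_one]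
  have hadd : (h₁ + C a).Monic := hh₁.add_of_left (degree_lt_degree (by simp; omega))
  have haddn : (h₁ + C a).natDegree = n := by rw [natDegree_add_C, hh₁n]
  have hrest : (u₁ - X ^ m - C e * X ^ (m - 1)).natDegree ≤ m - 2 := by
    rw [natDegree_le_iff_coeff_eq_zero]
    intro l hl
    simp only [coeff_sub, coeff_X_pow, coeff_C_mul]
    rcases lt_trichotomy l m with h1 | rfl | h1
    · have : l = m - 1 := by omega
      subst this
      rw [if_neg (by omega), if_pos rfl, ← he]
      ring
    · rw [if_pos rfl, if_neg (by omega), ← hu₁m, hu₁.coeff_natDegree]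
      ring
    · rw [if_neg (by omega), if_neg (by omega), coeff_eq_zero_of_natDegree_lt (by omega)]
      ring
  have hFrest : F = h₁ ^ m + C e * h₁ ^ (m - 1) +
      (u₁ - X ^ m - C e * X ^ (m - 1)).comp h₁ := by
    rw [hFu₁]
    simp only [sub_comp, mul_comp, pow_comp, X_comp, C_comp]
    ring
  have hcoeff : ∀ l, (m - 1) * n ≤ l → F.coeff l = ((h₁ + C a) ^ m).coeff l := by
    intro l hl
    have hQ := coeff_geom_sum hadd hh₁ haddn hh₁n m
    have hle := natDegree_geom_sum_le haddn.le hh₁n.le m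
    have hgeom := (Commute.all (h₁ + C a) h₁).mul_geom_sum₂ m
    rw [add_sub_cancel_left] at hgeom
    rw [← sub_add_cancel ((h₁ + C a) ^ m) (h₁ ^ m), ← hgeom, hFrest]
    have hmn : (m - 2) * n + n = (m - 1) * n := by
      rw [← Nat.succ_mul]; congr 1; omega
    have h0 : ((u₁ - X ^ m - C e * X ^ (m - 1)).comp h₁).coeff l = 0 := by
      refine coeff_eq_zero_of_natDegree_lt (lt_of_le_of_lt natDegree_comp_le ?_)
      rw [hh₁n]
      have := Nat.mul_le_mul_right n hrest
      omega
    have hpow : (h₁ ^ (m - 1)).Monic := hh₁.pow _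
    have hpown : (h₁ ^ (m - 1)).natDegree = (m - 1) * n := by rw [hh₁.natDegree_pow, hh₁n]
    simp only [coeff_add, h0, coeff_C_mul, add_zero]
    rcases hl.eq_or_lt with rfl | hl
    · rw [hQ, ← hpown, hpow.coeff_natDegree, hpown, ham]
      ring
    · rw [coeff_eq_zero_of_natDegree_lt (hle.trans_lt hl),
        coeff_eq_zero_of_natDegree_lt (hpown.trans_lt hl)]
      ring
  have hcoeff' : ∀ l, (m - 1) * n ≤ l → F.coeff l = (g ^ m).coeff l := by
    intro l hl
    obtain ⟨m', rfl⟩ := Nat.exists_eq_add_of_le' hm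
    rw [hFr, Finset.sum_range_succ, Finset.sum_range_succ, hrm,
      show r (m' + 1) = 0 from hrm1, zero_mul, add_zero, one_mul, coeff_add, add_eq_right]
    refine coeff_eq_zero_of_natDegree_lt (lt_of_lt_of_le ?_ hl)
    refine lt_of_le_of_lt (b := (m' + 1) * n - 1) ?_ ?_
    · refine natDegree_sum_le_of_forall_le _ _ fun i hi ↦ ?_
      have hi := Finset.mem_range.1 hi
      have h1 := hr i (by omega)
      have h2 : (g ^ i).natDegree = i * n := by rw [hg.natDegree_pow, hgn]
      have h3 := Nat.mul_le_mul_right n (show i + 1 ≤ m' + 1 by omega)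
      have h4 := natDegree_mul_le (p := r i) (q := g ^ i)
      rw [add_mul, one_mul] at h3
      omega
    · have : 0 < (m' + 1) * n := by positivity
      simp only [show m' + 2 - 1 = m' + 1 by omega]
      omega
  have hgh : g = h₁ + C a := approximate_root_unique hmk hg hadd hgn haddn fun l hl ↦ by
    rw [← hcoeff l hl, ← hcoeff' l hl]
  set u₂ := u₁.comp (X - C a) with hu₂
  have hu₂m : u₂.natDegree = m := by rw [hu₂, natDegree_comp, natDegree_X_sub_C, hu₁m, mul_one]
  have hF₂ : F = ∑ i ∈ Finset.range (m + 1), C (u₂.coeff i) * g ^ i := by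
    have : F = u₂.comp g := by
      rw [hu₂, comp_assoc, sub_comp, X_comp, C_comp, hgh, add_sub_cancel_right, hFu₁]
    rw [this, comp, eval₂_eq_sum_range, hu₂m]
  have hz : ∑ i ∈ Finset.range (m + 1), (r i - C (u₂.coeff i)) * g ^ i = 0 := by
    simp only [sub_mul, Finset.sum_sub_distrib]
    rw [← hFr, ← hF₂, sub_self]
  intro i hi
  have := eq_zero_of_adic_expansion_eq_zero (by omega) (m + 1) _ (fun i hi ↦ by
    refine (natDegree_sub_le _ _).trans_lt (max_lt ?_ ?_)
    · rw [hgn]; exact hr i (by omega)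
    · rw [natDegree_C]; omega) hz i (by omega)
  rw [sub_eq_zero.1 this, natDegree_C]

end Univariate

/-! ### The generic polynomial f(t + αx, x) and its degrees -/

section Line

variable {k : Type*} [Field k]

/-- The polynomial `f(t + α x, x)` in `k[α][t][x]`. -/
noncomputable def genericLine (f : MvPolynomial (Fin 2) k) : k[X][X][X] :=
  MvPolynomial.aeval ![C X + C (C X) * X, X] f

theorem genericLine_map_evalEval (f : MvPolynomial (Fin 2) k) (a b : k) :
    (genericLine f).map (evalEvalRingHom a b) = specialize f a b := by
  rw [genericLine, specialize, ← coe_mapRingHom]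
  induction f using MvPolynomial.induction_on with
  | C c =>
    simp only [MvPolynomial.aeval_C, Polynomial.algebraMap_apply, Algebra.algebraMap_self,
      RingHom.id_apply, coe_mapRingHom, map_C]
    simp [evalEvalRingHom]
  | add p q hp hq => simp only [map_add, hp, hq]
  | mul_X p i hp =>
    simp only [map_mul, hp, MvPolynomial.aeval_X]
    congr 1
    fin_cases i <;> simp

/-- The derivation ∂_α - x ∂_t kills both t + αx and x, hence every polynomial in them. -/
theorem lineDerivation_genericLine (f : MvPolynomial (Fin 2) k) :
    lineDerivation (coeffDerivation derivative') (derivative'.restrictScalars k)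
      (genericLine f) = 0 := by
  rw [genericLine]
  induction f using MvPolynomial.induction_on with
  | C c => rw [MvPolynomial.aeval_C, Derivation.map_algebraMap]
  | add p q hp hq => simp only [map_add, hp, hq, add_zero]
  | mul_X p i hp =>
    rw [map_mul, MvPolynomial.aeval_X, Derivation.leibniz, hp, smul_zero, add_zero]
    fin_cases i <;> simp [lineDerivation_apply]

theorem exists_ne_zero_of_coeff_mul_ne_zero {R S : Type*} [CommRing R] [AddCommMonoid S]
    (φ : R →+ S) {P Q : R[X]} {l : ℕ} (h : φ ((P * Q).coeff l) ≠ 0) :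
    ∃ a b, a + b = l ∧ φ (P.coeff a * Q.coeff b) ≠ 0 := by
  rw [coeff_mul, map_sum] at h
  obtain ⟨x, hx, h⟩ := Finset.exists_ne_zero_of_sum_ne_zero h
  exact ⟨x.1, x.2, Finset.HasAntidiagonal.mem_antidiagonal.1 hx, h⟩

theorem exists_ne_zero_of_coeff_coeff_mul_ne_zero {R : Type*} [CommRing R] {P Q : R[X][X]}
    {i q : ℕ} (h : ((P * Q).coeff i).coeff q ≠ 0) :
    ∃ i₁ i₂ q₁ q₂, i₁ + i₂ = i ∧ q₁ + q₂ = q ∧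
      (P.coeff i₁).coeff q₁ ≠ 0 ∧ (Q.coeff i₂).coeff q₂ ≠ 0 := by
  obtain ⟨i₁, i₂, hi, h⟩ := exists_ne_zero_of_coeff_mul_ne_zero (lcoeff R q).toAddMonoidHom h
  obtain ⟨q₁, q₂, hq, h⟩ := exists_ne_zero_of_coeff_mul_ne_zero (AddMonoidHom.id R) h
  exact ⟨i₁, i₂, q₁, q₂, hi, hq, left_ne_zero_of_mul h, right_ne_zero_of_mul h⟩

/-- Polynomials in `k[α][t][x]` of total degree at most `e` in `t, x` and of degree at most `e`
in `α`. -/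
def lineDegreeLE (k : Type*) [Field k] (e : ℕ) : Submodule k k[X][X][X] where
  carrier := {P | ∀ l i q, ((P.coeff l).coeff i).coeff q ≠ 0 → l + i ≤ e ∧ q ≤ e}
  add_mem' {P Q} hP hQ l i q h := by
    simp only [coeff_add] at h
    by_cases h' : ((P.coeff l).coeff i).coeff q = 0
    · exact hQ l i q fun h'' ↦ h (by rw [h', h'', add_zero])
    · exact hP l i q h'
  zero_mem' l i q h := by simp at h
  smul_mem' c P hP l i q h := by
    simp only [coeff_smul] at h
    exact hP l i q (right_ne_zero_of_smul h)

theorem mul_mem_lineDegreeLE {e e' : ℕ} {P Q : k[X][X][X]} (hP : P ∈ lineDegreeLE k e)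
    (hQ : Q ∈ lineDegreeLE k e') : P * Q ∈ lineDegreeLE k (e + e') := by
  intro l i q h
  obtain ⟨l₁, l₂, hl, h⟩ := exists_ne_zero_of_coeff_mul_ne_zero
    ((lcoeff k q).toAddMonoidHom.comp (lcoeff k[X] i).toAddMonoidHom) h
  obtain ⟨i₁, i₂, q₁, q₂, hi, hq, h1, h2⟩ := exists_ne_zero_of_coeff_coeff_mul_ne_zero h
  have := hP _ _ _ h1
  have := hQ _ _ _ h2
  omega

theorem one_mem_lineDegreeLE (e : ℕ) : (1 : k[X][X][X]) ∈ lineDegreeLE k e := by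
  intro l i q h
  simp only [coeff_one] at h
  split_ifs at h with h1
  · rw [coeff_one] at h
    split_ifs at h with h2
    · rw [coeff_one] at h
      split_ifs at h with h3
      · omega
      · simp at h
    · simp at h
  · simp at h

theorem pow_mem_lineDegreeLE {P : k[X][X][X]} (hP : P ∈ lineDegreeLE k 1) (j : ℕ) :
    P ^ j ∈ lineDegreeLE k j := by
  induction j with
  | zero => exact one_mem_lineDegreeLE 0
  | succ j ih => exact pow_succ P j ▸ mul_mem_lineDegreeLE ih hP

theorem lineDegreeLE_mono {e e' : ℕ} (h : e ≤ e') : lineDegreeLE k e ≤ lineDegreeLE k e' := by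
  intro P hP l i q h'
  have := hP l i q h'
  omega

theorem X_mem_lineDegreeLE : (X : k[X][X][X]) ∈ lineDegreeLE k 1 := by
  intro l i q h
  simp only [coeff_X] at h
  split_ifs at h with h1
  · rw [coeff_one] at h
    split_ifs at h with h2
    · rw [coeff_one] at h
      split_ifs at h with h3
      · omega
      · simp at h
    · simp at h
  · simp at h

theorem C_X_add_mem_lineDegreeLE : (C X + C (C X) * X : k[X][X][X]) ∈ lineDegreeLE k 1 := by
  refine add_mem ?_ ?_
  · intro l i q h
    simp only [coeff_C] at h
    split_ifs at h with h1
    · rw [coeff_X] at h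
      split_ifs at h with h2
      · rw [coeff_one] at h
        split_ifs at h with h3
        · omega
        · simp at h
      · simp at h
    · simp at h
  · intro l i q h
    simp only [coeff_C_mul, coeff_X] at h
    split_ifs at h with h1
    · rw [coeff_one] at h
      split_ifs at h with h2
      · rw [mul_one, coeff_X] at h
        split_ifs at h with h3
        · omega
        · simp at h
      · simp at h
    · simp at h

theorem genericLine_eq_sum (f : MvPolynomial (Fin 2) k) :
    genericLine f = ∑ s ∈ f.support,
      f.coeff s • ((C X + C (C X) * X) ^ s 0 * X ^ s 1) := by
  rw [genericLine, MvPolynomial.aeval_def, MvPolynomial.eval₂_eq']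
  refine Finset.sum_congr rfl fun s _ ↦ ?_
  rw [Fin.prod_univ_two, ← Algebra.smul_def]
  rfl

theorem add_le_totalDegree {f : MvPolynomial (Fin 2) k} {s : Fin 2 →₀ ℕ} (hs : s ∈ f.support) :
    s 0 + s 1 ≤ f.totalDegree := by
  have := MvPolynomial.le_totalDegree hs
  rwa [Finsupp.sum_fintype _ _ (fun _ ↦ rfl), Fin.sum_univ_two] at this

theorem genericLine_mem_lineDegreeLE (f : MvPolynomial (Fin 2) k) :
    genericLine f ∈ lineDegreeLE k f.totalDegree := by
  rw [genericLine_eq_sum]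
  refine sum_mem fun s hs ↦ Submodule.smul_mem _ _ (lineDegreeLE_mono (add_le_totalDegree hs) ?_)
  exact mul_mem_lineDegreeLE (pow_mem_lineDegreeLE C_X_add_mem_lineDegreeLE _)
    (pow_mem_lineDegreeLE X_mem_lineDegreeLE _)

/-- The leading coefficient of `f(t + α x, x)` as a polynomial in `x`; it lies in `k[α]`. -/
noncomputable def lineLeadingCoeff (f : MvPolynomial (Fin 2) k) : k[X] :=
  ((genericLine f).coeff f.totalDegree).coeff 0

theorem coeff_genericLine_totalDegree (f : MvPolynomial (Fin 2) k) :
    (genericLine f).coeff f.totalDegree = C (lineLeadingCoeff f) := by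
  ext i : 1
  rw [coeff_C]
  split_ifs with hi
  · subst hi; rfl
  · ext q
    by_contra h
    have := genericLine_mem_lineDegreeLE f _ _ _ h
    omega

theorem natDegree_lineLeadingCoeff_le (f : MvPolynomial (Fin 2) k) :
    (lineLeadingCoeff f).natDegree ≤ f.totalDegree := by
  rw [natDegree_le_iff_coeff_eq_zero]
  intro q hq
  by_contra h
  have := genericLine_mem_lineDegreeLE f _ _ _ h
  omega

/-- Setting t = 0 gives f(αx, x), so the leading coefficient is the top form of f evaluated at (α,
1); its monomials are told apart by their exponent of α. -/
theorem coeff_lineLeadingCoeff (f : MvPolynomial (Fin 2) k) {s : Fin 2 →₀ ℕ}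
    (hs : s 0 + s 1 = f.totalDegree) : (lineLeadingCoeff f).coeff (s 0) = f.coeff s := by
  have h : (genericLine f).map (evalRingHom (0 : k[X])) =
      ∑ s ∈ f.support, C (C (f.coeff s) * X ^ s 0) * X ^ (s 0 + s 1) := by
    rw [genericLine_eq_sum, Polynomial.map_sum]
    refine Finset.sum_congr rfl fun s _ ↦ ?_
    rw [Algebra.smul_def]
    simp only [Polynomial.map_mul, Polynomial.map_pow, Polynomial.map_add,
      Polynomial.algebraMap_apply, Algebra.algebraMap_self, RingHom.id_apply, map_C, map_X, coe_evalRingHom, eval_X, eval_C,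
      C_0, zero_add, C_mul, C_pow]
    ring
  have h2 : lineLeadingCoeff f = ((genericLine f).map (evalRingHom (0 : k[X]))).coeff
      f.totalDegree := by
    rw [coeff_map, coe_evalRingHom, lineLeadingCoeff, coeff_zero_eq_eval_zero]
  rw [h2, h, finsetSum_coeff, finsetSum_coeff]
  simp only [coeff_C_mul_X_pow]
  rw [Finset.sum_eq_single s]
  · rw [if_pos hs.symm, coeff_C_mul_X_pow, if_pos rfl]
  · intro s' _ hne
    split_ifs with h1
    · rw [coeff_C_mul_X_pow, if_neg]
      intro h2
      refine hne (Finsupp.ext fun i ↦ ?_)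
      fin_cases i
      · exact h2.symm
      · change s' 1 = s 1
        omega
    · rw [coeff_zero]
  · intro h1
    rw [if_pos hs.symm, MvPolynomial.notMem_support_iff.1 h1]
    simp

theorem lineLeadingCoeff_ne_zero {f : MvPolynomial (Fin 2) k} (hf : 0 < f.totalDegree) :
    lineLeadingCoeff f ≠ 0 := by
  have hne : f.support.Nonempty := by
    rw [Finset.nonempty_iff_ne_empty, Ne, MvPolynomial.support_eq_empty]
    rintro rfl
    simp at hf
  obtain ⟨s, hs, h⟩ := Finset.exists_mem_eq_sup f.support hne
    (fun s ↦ s.sum fun _ e ↦ e)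
  have h' : s 0 + s 1 = f.totalDegree := by
    rw [Finsupp.sum_fintype _ _ (fun _ ↦ rfl), Fin.sum_univ_two] at h
    rw [MvPolynomial.totalDegree, h]
  intro h0
  have := coeff_lineLeadingCoeff f h'
  rw [h0, coeff_zero] at this
  exact MvPolynomial.mem_support_iff.1 hs this.symm

theorem natDegree_genericLine {f : MvPolynomial (Fin 2) k} (hf : 0 < f.totalDegree) :
    (genericLine f).natDegree = f.totalDegree := by
  refine le_antisymm ?_ (le_natDegree_of_ne_zero ?_)
  · rw [natDegree_le_iff_coeff_eq_zero]
    intro l hl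
    ext i q
    by_contra h
    have := genericLine_mem_lineDegreeLE f _ _ _ h
    omega
  · rw [coeff_genericLine_totalDegree, C_ne_zero]
    exact lineLeadingCoeff_ne_zero hf

theorem leadingCoeff_genericLine {f : MvPolynomial (Fin 2) k} (hf : 0 < f.totalDegree) :
    (genericLine f).leadingCoeff = C (lineLeadingCoeff f) := by
  rw [leadingCoeff, natDegree_genericLine hf, coeff_genericLine_totalDegree]

/-- The subspaces of `k[α][t]` of polynomials of degree at most `j` in `t` and at most `d * j` in
`α`. -/
def biDegreeLE (k : Type*) [Field k] (d : ℕ) (j : ℤ) : Submodule k k[X][X] where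
  carrier := {a | ∀ i q, (a.coeff i).coeff q ≠ 0 → (i : ℤ) ≤ j ∧ (q : ℤ) ≤ d * j}
  add_mem' {P Q} hP hQ i q h := by
    simp only [coeff_add] at h
    by_cases h' : (P.coeff i).coeff q = 0
    · exact hQ i q fun h'' ↦ h (by rw [h', h'', add_zero])
    · exact hP i q h'
  zero_mem' i q h := by simp at h
  smul_mem' c P hP i q h := by
    simp only [coeff_smul] at h
    exact hP i q (right_ne_zero_of_smul h)

theorem one_mem_biDegreeLE (d : ℕ) : (1 : k[X][X]) ∈ biDegreeLE k d 0 := by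
  intro i q h
  rw [coeff_one] at h
  split_ifs at h with h2
  · rw [coeff_one] at h
    split_ifs at h with h3
    · simp [h2, h3]
    · simp at h
  · simp at h

theorem mul_mem_biDegreeLE (d : ℕ) (i j : ℤ) (a b : k[X][X]) (ha : a ∈ biDegreeLE k d i)
    (hb : b ∈ biDegreeLE k d j) : a * b ∈ biDegreeLE k d (i + j) := by
  intro l q h
  obtain ⟨i₁, i₂, q₁, q₂, rfl, rfl, h1, h2⟩ := exists_ne_zero_of_coeff_coeff_mul_ne_zero h
  have := ha _ _ h1
  have := hb _ _ h2
  rw [mul_add]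
  push_cast
  constructor <;> linarith

/-- For l < d the coefficient of x^l is multiplied by c^(d-1-l), so its α-degree is at most d +
d(d-1-l) = d(d-l). This is why `biDegreeLE` has slope d. -/
theorem integralNormalization_genericLine_mem {f : MvPolynomial (Fin 2) k}
    (hf : 0 < f.totalDegree) :
    (genericLine f).integralNormalization ∈
      weighted (biDegreeLE k f.totalDegree) f.totalDegree := by
  set d := f.totalDegree with hd
  have hdn := natDegree_genericLine hf
  intro l
  rcases lt_trichotomy l d with hl | hl | hl
  · rw [integralNormalization_coeff_ne_natDegree (by omega), leadingCoeff_genericLine hf, ← C_pow,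
      hdn]
    intro i q h
    rw [coeff_mul_C] at h
    obtain ⟨q₁, q₂, rfl, h'⟩ := exists_ne_zero_of_coeff_mul_ne_zero (AddMonoidHom.id k) h
    replace h' : (((genericLine f).coeff l).coeff i).coeff q₁ *
      (lineLeadingCoeff f ^ (d - 1 - l)).coeff q₂ ≠ 0 := h'
    have h1 := genericLine_mem_lineDegreeLE f _ _ _ (left_ne_zero_of_mul h')
    have h2 := (le_natDegree_of_ne_zero (right_ne_zero_of_mul h')).trans
      (natDegree_pow_le_of_le _ (natDegree_lineLeadingCoeff_le f))
    rw [← hd] at h1 h2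
    obtain ⟨s, hs⟩ := Nat.exists_eq_add_of_lt hl
    rw [show d - 1 - l = s by omega] at h2
    refine ⟨by omega, ?_⟩
    have h3 : (d : ℤ) - l = s + 1 := by omega
    rw [h3]
    have h4 : (q₂ : ℤ) ≤ s * d := by exact_mod_cast h2
    have h5 : (q₁ : ℤ) ≤ d := by exact_mod_cast h1.2
    push_cast
    linarith
  · have h0 : genericLine f ≠ 0 := ne_zero_of_natDegree_gt (hf.trans_eq hdn.symm)
    have h1 := integralNormalization_coeff_natDegree h0
    rw [hdn, ← hd] at h1
    rw [hl, sub_self, h1]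
    exact one_mem_biDegreeLE _
  · rw [coeff_eq_zero_of_natDegree_lt (by rw [natDegree_integralNormalization]; omega)]
    exact zero_mem _

end Line

/-! ### Test polynomials for decomposability -/

section Test

variable {k : Type*} [Field k]

/-- The expansion of a monic polynomial in powers of its approximate `m`-th root. -/
theorem exists_approximate_root_expansion {A : Type*} [CommRing A] [Nontrivial A] [Algebra k A]
    {M : ℤ → Submodule k A} (hone : 1 ∈ M 0)
    (hmul : ∀ i j a b, a ∈ M i → b ∈ M j → a * b ∈ M (i + j))
    {m n : ℕ} (hm : 2 ≤ m) (hn : 0 < n) (hmk : (m : k) ≠ 0) {F : A[X]} (hF : F.Monic)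
    (hFd : F.natDegree = m * n) (hFW : F ∈ weighted M (m * n : ℕ)) :
    ∃ (g : A[X]) (r : ℕ → A[X]), g.Monic ∧ g.natDegree = n ∧ (∀ i, (r i).natDegree < n) ∧
      (∀ i, r i ∈ weighted M ((m * n : ℕ) - (n * i : ℕ))) ∧
      r m = 1 ∧ (∀ i, m ≤ i + 1 → i ≠ m → r i = 0) ∧
      F = ∑ i ∈ Finset.range (m + 1), r i * g ^ i := by
  obtain ⟨g, hg, hgn, hgW, hgl⟩ := exists_approximate_root hone hmul hmk hF hFd hFW
  have hpow := pow_mem_weighted hone hmul hgW m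
  have hsub : F - g ^ m ∈ weighted M (m * n : ℕ) := sub_mem hFW (by exact_mod_cast hpow)
  obtain ⟨m, rfl⟩ := Nat.exists_eq_add_of_le' hm
  -- The original m is now m + 2. This bound stops the expansion of F - g^(m+2) at the digit m, so
  -- the digit m + 1 is zero.
  have hlt : (F - g ^ (m + 2)).natDegree < (m + 1) * g.natDegree := by
    rw [hgn]
    have hpos : 0 < (m + 1) * n := by positivity
    refine lt_of_le_of_lt (b := (m + 1) * n - 1) ?_ (by omega)
    rw [natDegree_le_iff_coeff_eq_zero]
    intro l hl
    exact hgl l (by rw [show m + 2 - 1 = m + 1 by omega]; omega)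
  obtain ⟨r, hrn, hrW, hFr⟩ := exists_adic_expansion hmul hg (by omega) (by rwa [hgn]) m _ _ hsub hlt
  refine ⟨g, fun i ↦ if i = m + 2 then 1 else if i ≤ m then r i else 0, hg, hgn, fun i ↦ ?_,
    fun i ↦ ?_, by simp, fun i hi hi' ↦ ?_, ?_⟩
  · dsimp only
    split_ifs
    · simpa using hn
    · rw [← hgn]; exact hrn i
    · simpa using hn
  · dsimp only
    split_ifs with h1 h2
    · subst h1
      rw [← monomial_zero_one]
      refine monomial_mem_weighted ?_
      rw [mul_comm n]
      simpa using hone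
    · have := hrW i
      rw [hgn] at this
      exact_mod_cast this
    · exact zero_mem _
  · dsimp only
    rw [if_neg hi', if_neg (by omega)]
  · dsimp only
    rw [Finset.sum_range_succ, Finset.sum_range_succ, if_pos rfl, if_neg (by omega),
      if_neg (by omega), zero_mul, add_zero, one_mul, ← sub_eq_iff_eq_add, hFr]
    refine Finset.sum_congr rfl fun i hi ↦ ?_
    have := Finset.mem_range.1 hi
    rw [if_neg (by omega), if_pos (by omega)]

theorem integralNormalization_comp {A : Type*} [CommRing A] {F : A[X]} (hF : 0 < F.natDegree) :
    F.integralNormalization.comp (C F.leadingCoeff * X) =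
      C (F.leadingCoeff ^ (F.natDegree - 1)) * F := by
  have := integralNormalization_eval₂_leadingCoeff_mul (p := F) hF C X
  rw [eval₂_C_X] at this
  rw [comp, this, C_pow]

/-- If the expansion of the normalized polynomial `f(t + α x, x)` in powers of its approximate
`m`-th root has constant coefficients, then `f` is decomposable. -/
theorem isMvDecomposable_of_expansion {f : MvPolynomial (Fin 2) k} (hf : 0 < f.totalDegree)
    (hchar : ∀ j : ℕ, 0 < j → j ≤ f.totalDegree → (j : k) ≠ 0)
    {m n : ℕ} (hm : 2 ≤ m) (hn : 2 ≤ n) (hmn : m * n = f.totalDegree)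
    {g : k[X][X][X]} (hg : g.Monic) (hgn : g.natDegree = n) (u : ℕ → k[X][X])
    (hum : u m = 1) (hu : ∀ i, m ≤ i + 1 → i ≠ m → u i = 0)
    (hud : ∀ i, (u i).natDegree ≤ f.totalDegree)
    (h : (genericLine f).integralNormalization =
      ∑ i ∈ Finset.range (m + 1), C (u i) * g ^ i) : IsMvDecomposable f := by
  set d := f.totalDegree with hd
  set c := lineLeadingCoeff f with hc
  have hc0 : c ≠ 0 := lineLeadingCoeff_ne_zero hf
  have hdn : (genericLine f).natDegree = d := natDegree_genericLine hf
  have hlc : (genericLine f).leadingCoeff = C c := leadingCoeff_genericLine hf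
  have hCc : (C c : k[X][X]) ≠ 0 := C_ne_zero.2 hc0
  have hmd : m ≤ d := by nlinarith
  set G := g.comp (C (C c) * X) with hG
  have hGn : G.natDegree = n := by
    rw [hG, natDegree_comp, natDegree_C_mul_X _ hCc, mul_one, hgn]
  have hGl : G.leadingCoeff = C (c ^ n) := by
    rw [hG, leadingCoeff_comp (by rw [natDegree_C_mul_X _ hCc]; omega), hg.leadingCoeff, one_mul,
      leadingCoeff_C_mul_X, hgn, C_pow]
  have hexp : C (C (c ^ (d - 1))) * genericLine f =
      ∑ i ∈ Finset.range (m + 1), C (u i) * G ^ i := by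
    have h1 := integralNormalization_comp (F := genericLine f) (by omega)
    rw [hlc, hdn, h, ← C_pow] at h1
    rw [← h1, sum_comp]
    refine Finset.sum_congr rfl fun i _ ↦ ?_
    rw [mul_comp, C_comp, pow_comp]
  have hmA : (m : k[X][X]) ≠ 0 := by
    rw [← C_eq_natCast, ← C_eq_natCast, C_ne_zero, C_ne_zero]
    exact hchar m (by omega) hmd
  have hder := derivation_eq_zero_of_lineDerivation_eq_zero (coeffDerivation derivative')
    (derivative'.restrictScalars k) (lineDerivation_genericLine f)
    (C_ne_zero.2 (pow_ne_zero (d - 1) hc0)) (by simp) (by omega) (by rw [hGl]; simp)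
    (by omega : 0 < m) hmA u hum (hu _ (by omega) (by omega)) (hu _ (by omega) (by omega)) hexp
  have huC : ∀ i ≤ m, u i = C ((u i).coeff 0) := by
    intro i hi
    have h0 : derivative (u i) = 0 := hder i hi
    refine eq_C_of_natDegree_eq_zero ?_
    by_contra hne
    obtain ⟨j, hj⟩ := Nat.exists_eq_add_one_of_ne_zero hne
    have h1 := congrArg (coeff · j) h0
    simp only [coeff_derivative, coeff_zero] at h1
    rw [← hj, ← Nat.cast_add_one, ← hj] at h1
    have h2 : (((u i).natDegree : ℕ) : k[X]) ≠ 0 := by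
      rw [← C_eq_natCast, C_ne_zero]
      exact hchar _ (by omega) (hud i)
    rcases mul_eq_zero.1 h1 with h3 | h3
    · rw [coeff_natDegree, leadingCoeff_eq_zero] at h3
      simp [h3] at hne
    · exact h2 h3
  classical
  -- The images of 0, …, d in k are distinct, while c has degree at most d.
  obtain ⟨a, ha⟩ : ∃ a : k, c.eval a ≠ 0 := by
    by_contra! hall
    have hinj : Set.InjOn (fun j : ℕ ↦ (j : k)) (Finset.range (d + 1)) := by
      intro i hi j hj hij
      simp only [Finset.coe_range, Set.mem_Iio] at hi hj
      by_contra hne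
      rcases lt_or_gt_of_ne hne with hlt | hlt
      · refine hchar (j - i) (by omega) (by omega) ?_
        rw [Nat.cast_sub hlt.le, sub_eq_zero]
        exact hij.symm
      · refine hchar (i - j) (by omega) (by omega) ?_
        rw [Nat.cast_sub hlt.le, sub_eq_zero]
        exact hij
    refine hc0 (eq_zero_of_natDegree_lt_card_of_eval_eq_zero' c
      ((Finset.range (d + 1)).image fun j : ℕ ↦ (j : k)) (fun x _ ↦ hall x) ?_)
    rw [Finset.card_image_of_injOn hinj, Finset.card_range]
    exact Nat.lt_succ_of_le (natDegree_lineLeadingCoeff_le f)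
  -- The substitution α ↦ a, t ↦ t - ax, x ↦ x sends t + αx to t, so it recovers f from the generic
  -- polynomial.
  set ψ : k[X][X][X] →+* MvPolynomial (Fin 2) k :=
    eval₂RingHom (eval₂RingHom (eval₂RingHom MvPolynomial.C (MvPolynomial.C a))
      (MvPolynomial.X 0 - MvPolynomial.C a * MvPolynomial.X 1)) (MvPolynomial.X 1) with hψ
  have hψC (w : k[X]) : ψ (C (C w)) = MvPolynomial.C (w.eval a) := by
    simp only [hψ, coe_eval₂RingHom, eval₂_C]
    rw [← eval₂_at_apply]
  have hψf (q : MvPolynomial (Fin 2) k) : ψ (genericLine q) = q := by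
    rw [genericLine]
    induction q using MvPolynomial.induction_on with
    | C r =>
      rw [MvPolynomial.aeval_C, Polynomial.algebraMap_apply, Polynomial.algebraMap_apply, hψC]
      simp
    | add p q hp hq => rw [map_add, map_add, hp, hq]
    | mul_X p i hp =>
      rw [map_mul, map_mul, hp, MvPolynomial.aeval_X]
      congr 1
      fin_cases i <;> simp [hψ]
  set b := (c ^ (d - 1)).eval a with hb
  have hb0 : b ≠ 0 := by
    rw [hb, eval_pow]
    exact pow_ne_zero _ ha
  have hfin : MvPolynomial.C b * f = ∑ i ∈ Finset.range (m + 1),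
      MvPolynomial.C (((u i).coeff 0).eval a) * ψ G ^ i := by
    have h1 := congrArg ψ hexp
    rw [map_mul, hψC, hψf, map_sum] at h1
    rw [h1]
    refine Finset.sum_congr rfl fun i hi ↦ ?_
    have := Finset.mem_range.1 hi
    rw [map_mul, map_pow, huC i (by omega), hψC, coeff_C_zero]
  refine ⟨∑ i ∈ Finset.range (m + 1), C (b⁻¹ * ((u i).coeff 0).eval a) * X ^ i, ψ G, ?_, ?_⟩
  · refine hm.trans (le_natDegree_of_ne_zero ?_)
    rw [finsetSum_coeff]
    simp only [coeff_C_mul_X_pow]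
    rw [Finset.sum_ite_eq, if_pos (by simp), hum]
    simpa using hb0
  · rw [map_sum]
    simp only [map_mul, aeval_C, map_pow, aeval_X, MvPolynomial.algebraMap_eq, mul_assoc]
    rw [← Finset.mul_sum, ← hfin, ← mul_assoc, ← map_mul, inv_mul_cancel₀ hb0, map_one, one_mul]

/-- For `d = m * n` there is a nonzero polynomial in `α, t` of controlled degree that vanishes
wherever `f(t + α x, x)` is a composition of polynomials of degrees `m` and `n`. -/
theorem exists_test_polynomial {f : MvPolynomial (Fin 2) k} (hf : IsMvIndecomposable f)
    (hchar : ∀ j : ℕ, 0 < j → j ≤ f.totalDegree → (j : k) ≠ 0)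
    {m n : ℕ} (hm : 2 ≤ m) (hn : 2 ≤ n) (hmn : m * n = f.totalDegree) :
    ∃ R : k[X][X], R ≠ 0 ∧ R ∈ biDegreeLE k f.totalDegree f.totalDegree ∧
      ∀ a b : k, (lineLeadingCoeff f).eval a ≠ 0 →
        (∃ u h : k[X], u.natDegree = m ∧ h.natDegree = n ∧ specialize f a b = u.comp h) →
        R.evalEval a b = 0 := by
  set d := f.totalDegree with hd
  have hdn : (genericLine f).natDegree = d := natDegree_genericLine hf.1
  have hlc : (genericLine f).leadingCoeff = C (lineLeadingCoeff f) := leadingCoeff_genericLine hf.1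
  have h0 : genericLine f ≠ 0 := ne_zero_of_natDegree_gt (hf.1.trans_eq hdn.symm)
  have hmk : (m : k) ≠ 0 := hchar m (by omega) (by nlinarith)
  have hmonic := monic_integralNormalization h0
  obtain ⟨g, r, hg, hgn, hrn, hrW, hrm, hr, hFr⟩ := exists_approximate_root_expansion
    (one_mem_biDegreeLE d) (mul_mem_biDegreeLE d) hm (by omega : 0 < n) hmk hmonic
    (by rw [natDegree_integralNormalization, hdn, hmn])
    (by rw [hmn]; exact integralNormalization_genericLine_mem hf.1)
  rw [hmn] at hrW
  have hle {i : ℤ} (hi : i ≤ d) : biDegreeLE k d i ≤ biDegreeLE k d d := by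
    intro a ha i q h
    have h1 := ha i q h
    exact ⟨h1.1.trans hi, h1.2.trans (mul_le_mul_of_nonneg_left hi (by positivity))⟩
  have hrd (i l : ℕ) : (r i).coeff l ∈ biDegreeLE k d d := hle (by push_cast; nlinarith) (hrW i l)
  by_cases hall : ∀ i ≤ m, (r i).natDegree = 0
  · have hC : ∀ i ≤ m, r i = C ((r i).coeff 0) := fun i hi ↦ eq_C_of_natDegree_eq_zero (hall i hi)
    refine absurd ?_ hf.2
    refine isMvDecomposable_of_expansion hf.1 hchar hm hn hmn hg hgn (fun i ↦ (r i).coeff 0) ?_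
      (fun i hi hi' ↦ ?_) (fun i ↦ ?_) ?_
    · simp only [hrm, coeff_one_zero]
    · simp only [hr i hi hi', coeff_zero]
    · rw [natDegree_le_iff_coeff_eq_zero]
      intro l hl
      ext q
      by_contra h
      have := hrd i 0 l q h
      omega
    · rw [hFr]
      refine Finset.sum_congr rfl fun i hi ↦ ?_
      have := Finset.mem_range.1 hi
      rw [← hC i (by omega)]
  · push Not at hall
    obtain ⟨i, hi, hri⟩ := hall
    -- The test polynomial is the top x-coefficient of a digit nonconstant in x; it must vanish
    -- wherever the specialized digit is constant.
    refine ⟨(r i).leadingCoeff, ?_, hrd i _, ?_⟩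
    · rw [leadingCoeff_ne_zero]
      rintro h
      simp [h] at hri
    · rintro a b hab ⟨u, h, hum, hhn, huh⟩
      set φ := evalEvalRingHom a b with hφ
      have hc : (genericLine f).leadingCoeff.evalEval a b ≠ 0 := by rwa [hlc, evalEval_C]
      set c := (genericLine f).leadingCoeff.evalEval a b with hcdef
      have hcomp : ((genericLine f).integralNormalization.map φ).comp (C c * X) =
          C (c ^ (d - 1)) * specialize f a b := by
        have h1 := congrArg (Polynomial.map φ) (integralNormalization_comp (F := genericLine f)
          (by rw [hdn]; exact hf.1))
        rw [Polynomial.map_comp, Polynomial.map_mul, Polynomial.map_mul, map_C, map_C, map_X,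
          hdn, map_pow, genericLine_map_evalEval] at h1
        exact h1
      have hdec : (genericLine f).integralNormalization.map φ =
          (C (c ^ (d - 1)) * u).comp (h.comp (C c⁻¹ * X)) := by
        have h1 := congrArg (fun P : k[X] ↦ P.comp (C c⁻¹ * X)) hcomp
        simp only [comp_assoc, mul_comp, C_comp, X_comp] at h1
        rw [← mul_assoc, ← C_mul, mul_inv_cancel₀ hc, C_1, one_mul, comp_X, huh, comp_assoc] at h1
        rw [h1, mul_comp, C_comp]
      have hconst := adic_coeff_eq_C_of_eq_comp hm hmk (by omega : 0 < n) (hmonic.map φ)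
        (hg.map φ) (by rw [hg.natDegree_map, hgn]) (fun i ↦ (r i).map φ)
        (fun i _ ↦ natDegree_map_le.trans_lt (hrn i)) (by simp [hrm])
        (by rw [hr (m - 1) (by omega) (by omega), Polynomial.map_zero])
        (by rw [hFr, Polynomial.map_sum]; simp only [Polynomial.map_mul, Polynomial.map_pow])
        (by rw [natDegree_C_mul (pow_ne_zero _ hc), hum])
        (by rw [natDegree_comp, natDegree_C_mul_X _ (inv_ne_zero hc), mul_one, hhn]) hdec i hi
      have h2 : ((r i).map φ).coeff (r i).natDegree = 0 :=
        coeff_eq_zero_of_natDegree_lt (by omega)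
      rwa [coeff_map] at h2

end Test

/-! ### Counting the bad pairs -/

section Count

variable {k : Type*} [Field k]

/-- Schwartz–Zippel by fibres: at most d₂ values of a kill the leading coefficient, each costing at
most |S| pairs; every other fibre has at most d₁ zeros. -/
theorem card_filter_evalEval_eq_zero_le [DecidableEq k] {R : k[X][X]} (hR : R ≠ 0) {d₁ d₂ : ℕ}
    (h₁ : R.natDegree ≤ d₁) (h₂ : ∀ i, (R.coeff i).natDegree ≤ d₂) (S : Finset k) :
    ((S ×ˢ S).filter fun w ↦ R.evalEval w.1 w.2 = 0).card ≤ (d₁ + d₂) * S.card := by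
  have hroots {q : k[X]} (hq : q ≠ 0) : (S.filter fun a ↦ q.eval a = 0).card ≤ q.natDegree := by
    refine (Finset.card_le_card fun a ha ↦ ?_).trans
      ((Multiset.toFinset_card_le q.roots).trans q.card_roots')
    rw [Multiset.mem_toFinset, mem_roots hq]
    exact (Finset.mem_filter.1 ha).2
  have hfib (a : k) : (S.filter fun b ↦ R.evalEval a b = 0).card ≤
      d₁ + if R.leadingCoeff.eval a = 0 then S.card else 0 := by
    split_ifs with ha
    · exact (Finset.card_filter_le _ _).trans (Nat.le_add_left _ _)
    · have hne : R.map (evalRingHom a) ≠ 0 := by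
        intro h0
        have := congrArg (coeff · R.natDegree) h0
        rw [coeff_map] at this
        exact ha this
      have heq (b : k) : R.evalEval a b = (R.map (evalRingHom a)).eval b :=
        (map_evalRingHom_eval a b R).symm
      simp only [heq]
      exact (hroots hne).trans (natDegree_map_le.trans h₁)
  rw [Finset.card_filter, Finset.sum_product]
  simp only [← Finset.card_filter]
  refine (Finset.sum_le_sum fun a _ ↦ hfib a).trans ?_
  rw [Finset.sum_add_distrib, Finset.sum_const, ← Finset.sum_filter, Finset.sum_const, smul_eq_mul,
    smul_eq_mul, add_mul, mul_comm d₁]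
  exact Nat.add_le_add_left (Nat.mul_le_mul_right _
    ((hroots (leadingCoeff_ne_zero.2 hR)).trans (h₂ _))) _

theorem natDegree_specialize {f : MvPolynomial (Fin 2) k} (hf : 0 < f.totalDegree) {a b : k}
    (ha : (lineLeadingCoeff f).eval a ≠ 0) : (specialize f a b).natDegree = f.totalDegree := by
  rw [← genericLine_map_evalEval, ← natDegree_genericLine hf]
  refine natDegree_map_of_leadingCoeff_ne_zero _ ?_
  rw [leadingCoeff_genericLine hf]
  change (C (lineLeadingCoeff f)).evalEval a b ≠ 0
  rwa [evalEval_C]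

theorem card_filter_not_isIndecomposable_le {f : MvPolynomial (Fin 2) k}
    (hf : IsMvIndecomposable f) (hchar : ∀ j : ℕ, 0 < j → j ≤ f.totalDegree → (j : k) ≠ 0)
    (S : Finset k) [DecidablePred fun w : k × k ↦ ¬ IsIndecomposable (specialize f w.1 w.2)] :
    ((S ×ˢ S).filter fun w ↦ ¬ IsIndecomposable (specialize f w.1 w.2)).card ≤
      (f.totalDegree + f.totalDegree.divisors.card * (f.totalDegree + f.totalDegree ^ 2)) *
        S.card := by
  classical
  set d := f.totalDegree with hd
  set T := d.divisors.filter fun m ↦ 2 ≤ m ∧ 2 ≤ d / m with hT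
  have htest : ∀ m ∈ T, ∃ R : k[X][X], R ≠ 0 ∧ R ∈ biDegreeLE k d d ∧
      ∀ a b : k, (lineLeadingCoeff f).eval a ≠ 0 →
        (∃ u h : k[X], u.natDegree = m ∧ h.natDegree = d / m ∧ specialize f a b = u.comp h) →
        R.evalEval a b = 0 := by
    intro m hm
    obtain ⟨hm, hm2, hn2⟩ := Finset.mem_filter.1 hm
    exact exists_test_polynomial hf hchar hm2 hn2 (Nat.mul_div_cancel' (Nat.dvd_of_mem_divisors hm))
  choose! R hR0 hRd hR using htest
  -- Either the degree may drop, because c(a) = 0, or the specialization has degree d and decomposes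
  -- with outer degree m for some m in T.
  have hsub : ((S ×ˢ S).filter fun w ↦ ¬ IsIndecomposable (specialize f w.1 w.2)) ⊆
      ((S ×ˢ S).filter fun w ↦ (C (lineLeadingCoeff f) : k[X][X]).evalEval w.1 w.2 = 0) ∪
      T.biUnion fun m ↦ (S ×ˢ S).filter fun w ↦ (R m).evalEval w.1 w.2 = 0 := by
    intro w hw
    obtain ⟨hw, hdec⟩ := Finset.mem_filter.1 hw
    rw [Finset.mem_union, Finset.mem_filter, evalEval_C, Finset.mem_biUnion]
    by_cases hc : (lineLeadingCoeff f).eval w.1 = 0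
    · exact Or.inl ⟨hw, hc⟩
    refine Or.inr ?_
    have hdeg := natDegree_specialize hf.1 (b := w.2) hc
    rw [← hd] at hdeg
    rw [IsIndecomposable, not_and_not_right] at hdec
    obtain ⟨u, g, hu, hg, hug⟩ := hdec (by rw [hdeg]; exact hf.1)
    have hmul : u.natDegree * g.natDegree = d := by rw [← natDegree_comp, ← hug, hdeg]
    have hdiv : d / u.natDegree = g.natDegree := by
      rw [← hmul, Nat.mul_div_cancel_left _ (by omega)]
    have hmem : u.natDegree ∈ T := by
      refine Finset.mem_filter.2 ⟨Nat.mem_divisors.2 ⟨⟨_, hmul.symm⟩, hf.1.ne'⟩, hu, ?_⟩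
      rwa [hdiv]
    exact ⟨_, hmem, Finset.mem_filter.2 ⟨hw, hR _ hmem _ _ hc ⟨u, g, rfl, hdiv.symm, hug⟩⟩⟩
  refine (Finset.card_le_card hsub).trans ((Finset.card_union_le _ _).trans ?_)
  rw [add_mul]
  refine add_le_add ?_ ?_
  · have := card_filter_evalEval_eq_zero_le (R := C (lineLeadingCoeff f)) (d₁ := 0) (d₂ := d)
      (C_ne_zero.2 (lineLeadingCoeff_ne_zero hf.1)) (natDegree_C _).le (fun i ↦ by
        rw [coeff_C]
        split_ifs
        · exact natDegree_lineLeadingCoeff_le f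
        · simp) S
    rwa [zero_add] at this
  · refine Finset.card_biUnion_le.trans ((Finset.sum_le_card_nsmul T _ ((d + d ^ 2) * S.card)
      fun m hm ↦ ?_).trans ?_)
    · refine card_filter_evalEval_eq_zero_le (hR0 m hm) ?_ (fun i ↦ ?_) S
      · rw [natDegree_le_iff_coeff_eq_zero]
        intro l hl
        ext q
        by_contra h
        have := hRd m hm l q h
        omega
      · rw [natDegree_le_iff_coeff_eq_zero]
        intro q hq
        by_contra h
        have := (hRd m hm i q h).2
        rw [← sq] at this
        exact absurd hq (not_lt.2 (by exact_mod_cast this))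
    · rw [smul_eq_mul, mul_assoc]
      exact Nat.mul_le_mul_right _ (Finset.card_filter_le _ _)

end Count

theorem mainTheorem7 {k : Type*} [Field k] (p : ℕ) [CharP k p] (d : ℕ)
    (f : MvPolynomial (Fin 2) k) (hfd : f.totalDegree = d) (hp : p = 0 ∨ d < p)
    (hf : IsMvIndecomposable f) (S : Finset k) (hS : S.Nonempty) :
    (1 : ℝ) - ((ArithmeticFunction.sigma 1 d * d ^ 2 + 2 * ArithmeticFunction.sigma 0 d * d : ℕ) : ℝ)
        / (S.card : ℝ) ≤
      ((PMF.uniformOfFinset (S ×ˢ S) (hS.product hS)).toOuterMeasure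
        {w : k × k | IsIndecomposable (specialize f w.1 w.2)}).toReal := by
  classical
  have hchar : ∀ j : ℕ, 0 < j → j ≤ f.totalDegree → (j : k) ≠ 0 := by
    intro j hj hjd h
    have hdvd := (CharP.cast_eq_zero_iff k p j).1 h
    rcases hp with rfl | hp
    · rw [zero_dvd_iff] at hdvd
      omega
    · have := Nat.le_of_dvd hj hdvd
      omega
  have hbad := card_filter_not_isIndecomposable_le hf hchar S
  have hd0 := hf.1
  rw [hfd] at hbad hd0
  -- The count obtained is sharper than 𝒟; it suffices that 1 ≤ σ₀(d) ≤ σ₁(d).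
  have hσ : d + d.divisors.card * (d + d ^ 2) ≤
      ArithmeticFunction.sigma 1 d * d ^ 2 + 2 * ArithmeticFunction.sigma 0 d * d := by
    have h1 : d.divisors.card ≤ ArithmeticFunction.sigma 1 d := by
      rw [ArithmeticFunction.sigma_one_apply, Finset.card_eq_sum_ones]
      exact Finset.sum_le_sum fun m hm ↦ Nat.pos_of_mem_divisors hm
    have h2 : 0 < d.divisors.card :=
      Finset.card_pos.2 ⟨1, Nat.one_mem_divisors.2 hd0.ne'⟩
    rw [ArithmeticFunction.sigma_zero_apply]
    nlinarith [Nat.mul_le_mul_right (d ^ 2) h1, Nat.mul_le_mul_right d h2]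
  rw [PMF.toOuterMeasure_uniformOfFinset_apply, ENNReal.toReal_div, ENNReal.toReal_natCast,
    ENNReal.toReal_natCast, Finset.card_product]
  have hsum := Finset.card_filter_add_card_filter_not (s := S ×ˢ S)
    (fun w : k × k ↦ IsIndecomposable (specialize f w.1 w.2))
  rw [Finset.card_product] at hsum
  have hle := hbad.trans (Nat.mul_le_mul_right S.card hσ)
  have hN : (0 : ℝ) < S.card := by exact_mod_cast hS.card_pos
  simp only [Set.mem_ofPred_eq]
  set 𝒟 := ArithmeticFunction.sigma 1 d * d ^ 2 + 2 * ArithmeticFunction.sigma 0 d * d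
  have hsum' := congrArg (Nat.cast (R := ℝ)) hsum
  have hle' : ((((S ×ˢ S).filter fun w ↦ ¬ IsIndecomposable (specialize f w.1 w.2)).card : ℕ) : ℝ) ≤
    ((𝒟 * S.card : ℕ) : ℝ) := Nat.cast_le.2 hle
  push_cast at hsum' hle' ⊢
  rw [le_div_iff₀ (by positivity), sub_mul, one_mul, div_mul_eq_mul_div, mul_div_assoc,
    mul_self_div_self]
  linarith
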